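/- Let $X$ be a complex manifold with complex structure $J$, let $g$ be a (smooth) Hermitian metric on $X$, i.e. a Riemannian metric with $g(J\cdot,J\cdot)=g$, and put $\omega(\cdot,\cdot)=g(\cdot,J\cdot)$. Let $\nabla^B$ be the Bismut connection of $g$, i.e. the unique affine connection with $\nabla^B g=0$, $\nabla^B J=0$ whose torsion $T^B(x,y)=\nabla^B_xy-\nabla^B_yx-[x,y]$ is totally skew-symmetric, meaning that $T^B(x,y,z):=g(T^B(x,y),z)$ is a $3$-form; equivalently, $g(\nabla^B_xy,z)=g(\nabla^{LC}_xy,z)+\tfrac12 d^c\omega(x,y,z)$, where $\nabla^{LC}$ is the Levi-Civita connection and $d^c\omega(x,y,z)=-d\omega(Jx,Jy,Jz)$. Let $R^B(x,y)z=\nabla^B_x\nabla^B_yz-\nabla^B_y\nabla^B_xz-\nabla^B_{[x,y]}z$ be its curvature. Say that $\nabla^B$ satisfies the first Bianchi identity if $R^B(x,y)z+R^B(y,z)x+R^B(z,x)y=0$ for all tangent vectors $x,y,z$, and that $g$ is SKT if the $3$-form $T^B$ is closed, $dT^B=0$. Then: (a) if $\nabla^B$ satisfies the first Bianchi identity, then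 $\nabla^BT^B=0$ if and only if $g$ is SKT; (b) if $\nabla^BT^B=0$, then $\nabla^B$ satisfies the first Bianchi identity if and only if $g$ is SKT. -/

import Mathlib

set_option maxSynthPendingDepth 3

open scoped Manifold ContDiff Topology

/-- A complex manifold is in particular a smooth real manifold, for the same charts. -/
instance IsManifold.realOfComplex {E : Type*} [NormedAddCommGroup E] [NormedSpace ℂ E]
    {X : Type*} [TopologicalSpace X] [ChartedSpace E X] {n : ℕ∞ω} [IsManifold 𝓘(ℂ, E) n X] :
    IsManifold 𝓘(ℝ, E) n X := by
  refine isManifold_of_contDiffOn 𝓘(ℝ, E) n X fun e e' he he' => ?_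
  have h := HasGroupoid.compatible (G := contDiffGroupoid n 𝓘(ℂ, E)) he he'
  have h' := (contDiffGroupoid n 𝓘(ℂ, E)).mem_iff_of_eqOnSource (Setoid.refl _) |>.1 h
  rw [contDiffGroupoid, mem_groupoid_of_pregroupoid] at h'
  have h2 := h'.1
  simp only [contDiffPregroupoid] at h2
  intro p hp
  exact (h2 p (by simpa using hp)).restrict_scalars ℝ |>.congr_of_eventuallyEq
    (by simp) (by simp) |>.mono (by simp)

noncomputable section

namespace HermitianGeometry

/-! ### Local Hermitian geometry on an open subset of a complex vector space

A metric is given by its coefficient field `G`, i.e. `G p u v = g_p(u, v)` for constant vector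
fields `u`, `v`; the complex structure `J` is multiplication by `i`. All formulas below are
written for constant vector fields, whose Lie brackets vanish. -/

section Local

variable {E : Type*} [NormedAddCommGroup E] [NormedSpace ℂ E]

/-- The complex structure: multiplication by `i`, as a real linear map. -/
def mulI (E : Type*) [NormedAddCommGroup E] [NormedSpace ℂ E] : E →L[ℝ] E :=
  Complex.I • ContinuousLinearMap.id ℝ E

theorem mulI_apply (v : E) : mulI E v = Complex.I • v := rfl

theorem mulI_mulI (v : E) : mulI E (mulI E v) = -v := by
  simp [mulI_apply, smul_smul]

/-- The fundamental form `ω(u, v) = g(u, J v)`. -/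
def fundamentalForm (G : E → E →L[ℝ] E →L[ℝ] ℝ) (p : E) : E →L[ℝ] E →L[ℝ] ℝ :=
  (G p).bilinearComp (ContinuousLinearMap.id ℝ E) (mulI E)

/-- The exterior derivative of a 2-form `α`:
`dα(u, v, w) = D_u (α(v, w)) - D_v (α(u, w)) + D_w (α(u, v))`. -/
def extDerivTwo (α : E → E →L[ℝ] E →L[ℝ] ℝ) (p u v : E) : E →L[ℝ] ℝ :=
  fderiv ℝ α p u v - fderiv ℝ α p v u + ((fderiv ℝ α p).flip u).flip v

/-- The exterior derivative of a 3-form `β`: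
`dβ(x, y, z, u) = D_x (β(y, z, u)) - D_y (β(x, z, u)) + D_z (β(x, y, u)) - D_u (β(x, y, z))`. -/
def extDerivThree (β : E → E → E → E → ℝ) (p x y z u : E) : ℝ :=
  fderiv ℝ (fun q => β q y z u) p x - fderiv ℝ (fun q => β q x z u) p y
    + fderiv ℝ (fun q => β q x y u) p z - fderiv ℝ (fun q => β q x y z) p u

/-- The 3-form `d^c ω = - J⁻¹ d J ω`, i.e. `d^c ω(u, v, w) = - dω(J u, J v, J w)`
(`J` acts on forms by pull-back along `J⁻¹`, and `J ω = ω`). -/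
def dcFundamentalForm (G : E → E →L[ℝ] E →L[ℝ] ℝ) (p u v : E) : E →L[ℝ] ℝ :=
  -((extDerivTwo (fundamentalForm G) p (mulI E u) (mulI E v)).comp (mulI E))

/-- The linear form `w ↦ g(∇^{LC}_u v, w)` given by Koszul's formula:
`2 g(∇^{LC}_u v, w) = D_u (g(v, w)) + D_v (g(u, w)) - D_w (g(u, v))`. -/
def koszul (G : E → E →L[ℝ] E →L[ℝ] ℝ) (p u v : E) : E →L[ℝ] ℝ :=
  (1 / 2 : ℝ) • (fderiv ℝ G p u v + fderiv ℝ G p v u - ((fderiv ℝ G p).flip u).flip v)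

/-- The Bismut connection: `bismut G p u v` is the value `∇^B_u v` at `p`, for constant vector
fields `u` and `v`, determined by `g(∇^B_u v, w) = g(∇^{LC}_u v, w) + (1/2) d^c ω(u, v, w)`.
See `bismut_isHermitianSkew` and `HermitianSkewAt.eq_bismut` for the fact that it is the unique
Hermitian connection with totally skew-symmetric torsion. -/
def bismut (G : E → E →L[ℝ] E →L[ℝ] ℝ) (p u v : E) : E :=
  (G p).inverse (koszul G p u v + (1 / 2 : ℝ) • dcFundamentalForm G p u v)

/-- The torsion `T^B(u, v) = ∇^B_u v - ∇^B_v u`. -/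
def torsion (G : E → E →L[ℝ] E →L[ℝ] ℝ) (p u v : E) : E :=
  bismut G p u v - bismut G p v u

/-- The torsion as a covariant tensor, `T^B(u, v, w) = g(T^B(u, v), w)`. -/
def torsionForm (G : E → E →L[ℝ] E →L[ℝ] ℝ) (p u v w : E) : ℝ :=
  G p (torsion G p u v) w

/-- The covariant derivative of the torsion, `(∇^B_u T^B)(x, y, z)`. -/
def covDerivTorsion (G : E → E →L[ℝ] E →L[ℝ] ℝ) (p u x y z : E) : ℝ :=
  fderiv ℝ (fun q => torsionForm G q x y z) p u
    - torsionForm G p (bismut G p u x) y z - torsionForm G p x (bismut G p u y) z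
    - torsionForm G p x y (bismut G p u z)

/-- The curvature `R^B(x, y) z = ∇^B_x ∇^B_y z - ∇^B_y ∇^B_x z`: for a vector field `Y` and
a constant vector field `x`, `∇^B_x Y = D_x Y + bismut G p x (Y p)`. -/
def curvature (G : E → E →L[ℝ] E →L[ℝ] ℝ) (p x y z : E) : E :=
  (fderiv ℝ (fun q => bismut G q y z) p x + bismut G p x (bismut G p y z))
    - (fderiv ℝ (fun q => bismut G q x z) p y + bismut G p y (bismut G p x z))

/-- A connection with coefficients `Γ u v = ∇_u v` at `p` is Hermitian (`∇ g = 0`, `∇ J = 0`)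
and has totally skew-symmetric torsion. -/
structure HermitianSkewAt (G : E → E →L[ℝ] E →L[ℝ] ℝ) (p : E) (Γ : E → E → E) : Prop where
  metric : ∀ u v w, fderiv ℝ (fun q => G q v w) p u = G p (Γ u v) w + G p v (Γ u w)
  complex : ∀ u v, Γ u (mulI E v) = mulI E (Γ u v)
  skew : ∀ u v w, G p (Γ u v - Γ v u) w = - G p (Γ u w - Γ w u) v

/-- `G` is, near `p`, a differentiable field of nondegenerate symmetric `J`-invariant forms. -/
structure IsHermitianNear (G : E → E →L[ℝ] E →L[ℝ] ℝ) (p : E) : Prop where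
  diff : DifferentiableAt ℝ G p
  inv : (G p).IsInvertible
  symm : ∀ᶠ q in 𝓝 p, ∀ v w, G q v w = G q w v
  herm : ∀ᶠ q in 𝓝 p, ∀ v w, G q (mulI E v) (mulI E w) = G q v w

namespace IsHermitianNear

variable {G : E → E →L[ℝ] E →L[ℝ] ℝ} {p : E}

theorem fderiv_apply (h : IsHermitianNear G p) (u v w : E) :
    fderiv ℝ (fun q => G q v w) p u = fderiv ℝ G p u v w := by
  have h1 : HasFDerivAt (fun q => G q v w) _ p :=
    (h.diff.hasFDerivAt.clm_apply (hasFDerivAt_const v p)).clm_apply (hasFDerivAt_const w p)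
  rw [h1.fderiv]; simp

theorem fderiv_symm (h : IsHermitianNear G p) (u v w : E) :
    fderiv ℝ G p u v w = fderiv ℝ G p u w v := by
  rw [← h.fderiv_apply, ← h.fderiv_apply]
  congr 1
  exact Filter.EventuallyEq.fderiv_eq (h.symm.mono fun q hq => hq v w)

theorem fderiv_herm (h : IsHermitianNear G p) (u v w : E) :
    fderiv ℝ G p u (mulI E v) (mulI E w) = fderiv ℝ G p u v w := by
  rw [← h.fderiv_apply, ← h.fderiv_apply]
  congr 1
  exact Filter.EventuallyEq.fderiv_eq (h.herm.mono fun q hq => hq v w)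

theorem fderiv_fundamentalForm (h : IsHermitianNear G p) (u v w : E) :
    fderiv ℝ (fundamentalForm G) p u v w = fderiv ℝ G p u v (mulI E w) := by
  obtain ⟨L, hL⟩ : ∃ L : (E →L[ℝ] E →L[ℝ] ℝ) →L[ℝ] (E →L[ℝ] E →L[ℝ] ℝ),
      ∀ B v w, L B v w = B v (mulI E w) :=
    ⟨ContinuousLinearMap.compL ℝ E (E →L[ℝ] ℝ) (E →L[ℝ] ℝ)
      ((ContinuousLinearMap.compL ℝ E E ℝ).flip (mulI E)), fun _ _ _ => rfl⟩
  have h0 : fundamentalForm G = fun q => L (G q) := by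
    ext q v w
    rw [hL]; rfl
  have h1 : HasFDerivAt (fun q => L (G q)) (L.comp (fderiv ℝ G p)) p :=
    L.hasFDerivAt.comp p h.diff.hasFDerivAt
  rw [h0, h1.fderiv]
  exact hL _ _ _

theorem apply_bismut (h : IsHermitianNear G p) (u v w : E) :
    G p (bismut G p u v) w = koszul G p u v w + (1 / 2 : ℝ) * dcFundamentalForm G p u v w := by
  obtain ⟨e, he⟩ := h.inv
  rw [bismut, ← he]
  simp

theorem koszul_apply (_h : IsHermitianNear G p) (u v w : E) :
    koszul G p u v w = (1 / 2 : ℝ) *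
      (fderiv ℝ G p u v w + fderiv ℝ G p v u w - fderiv ℝ G p w u v) := rfl

theorem dcFundamentalForm_apply (h : IsHermitianNear G p) (u v w : E) :
    dcFundamentalForm G p u v w = fderiv ℝ G p (mulI E u) (mulI E v) w
      - fderiv ℝ G p (mulI E v) (mulI E u) w + fderiv ℝ G p (mulI E w) (mulI E u) v := by
  have : dcFundamentalForm G p u v w =
    -(fderiv ℝ (fundamentalForm G) p (mulI E u) (mulI E v) (mulI E w)
      - fderiv ℝ (fundamentalForm G) p (mulI E v) (mulI E u) (mulI E w)
      + fderiv ℝ (fundamentalForm G) p (mulI E w) (mulI E u) (mulI E v)) := rfl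
  rw [this]
  simp only [h.fderiv_fundamentalForm, mulI_mulI, map_neg]
  ring

theorem key (h : IsHermitianNear G p) (u v w : E) :
    fderiv ℝ G p u (mulI E v) w = - fderiv ℝ G p u v (mulI E w) := by
  have := h.fderiv_herm u v (mulI E w)
  rw [mulI_mulI, map_neg] at this
  linarith

theorem bismut_apply (h : IsHermitianNear G p) (u v w : E) :
    G p (bismut G p u v) w = (1 / 2 : ℝ) *
      (fderiv ℝ G p u v w + fderiv ℝ G p v u w - fderiv ℝ G p w u v) + (1 / 2 : ℝ) *
      (fderiv ℝ G p (mulI E u) (mulI E v) w - fderiv ℝ G p (mulI E v) (mulI E u) w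
        + fderiv ℝ G p (mulI E w) (mulI E u) v) := by
  rw [h.apply_bismut, h.koszul_apply, h.dcFundamentalForm_apply]

end IsHermitianNear

/-- The Bismut connection is Hermitian with totally skew-symmetric torsion. -/
theorem bismut_isHermitianSkew {G : E → E →L[ℝ] E →L[ℝ] ℝ} {p : E} (h : IsHermitianNear G p) :
    HermitianSkewAt G p (bismut G p) := by
  have hs := fun v w => h.symm.self_of_nhds v w
  have hh := fun v w => h.herm.self_of_nhds v w
  have hinj : ∀ a b : E, (∀ w, G p a w = G p b w) → a = b := fun a b hab =>
    h.inv.injective (ContinuousLinearMap.ext hab)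
  have ds := h.fderiv_symm
  have dh := h.fderiv_herm
  have key := h.key
  have hb := h.bismut_apply
  have hJ : ∀ v w, G p (mulI E v) w = - G p v (mulI E w) := by
    intro v w
    have := hh v (mulI E w)
    rw [mulI_mulI, map_neg] at this
    linarith
  refine ⟨fun u v w => ?_, fun u v => hinj _ _ fun w => ?_, fun u v w => ?_⟩
  · rw [hs v, hb, hb, h.fderiv_apply]
    linear_combination (1 / 2 : ℝ) * ds u v w - (1 / 2 : ℝ) * key (mulI E u) v w
      + (1 / 2 : ℝ) * ds (mulI E u) v (mulI E w)
  · rw [hJ, hb, hb]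
    simp only [mulI_mulI, map_neg, neg_apply]
    linear_combination (1 / 2 : ℝ) * key u v w - (1 / 2 : ℝ) * dh (mulI E v) u w
      - (1 / 2 : ℝ) * key w u v + (1 / 2 : ℝ) * dh (mulI E u) v w
      + (1 / 2 : ℝ) * key v u w + (1 / 2 : ℝ) * dh (mulI E w) u v
  · have hA : ∀ a b c, fderiv ℝ G p a (mulI E b) c = - fderiv ℝ G p a (mulI E c) b :=
      fun a b c => by rw [key, ds]
    simp only [map_sub, sub_apply, hb]
    linear_combination - (1 / 2 : ℝ) * ds w u v - (1 / 2 : ℝ) * ds v u w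
      + hA (mulI E u) v w - (1 / 2 : ℝ) * hA (mulI E v) u w - (1 / 2 : ℝ) * hA (mulI E w) u v

/-- The Bismut connection is the only Hermitian connection with totally skew-symmetric torsion. -/
theorem HermitianSkewAt.eq_bismut {G : E → E →L[ℝ] E →L[ℝ] ℝ} {p : E} (h : IsHermitianNear G p)
    {Γ : E → E → E} (hΓ : HermitianSkewAt G p Γ) : Γ = bismut G p := by
  have hs := fun v w => h.symm.self_of_nhds v w
  have hh := fun v w => h.herm.self_of_nhds v w
  have hinj : ∀ a b : E, (∀ w, G p a w = G p b w) → a = b := fun a b hab =>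
    h.inv.injective (ContinuousLinearMap.ext hab)
  have hJ : ∀ v w, G p (mulI E v) w = - G p v (mulI E w) := by
    intro v w
    have := hh v (mulI E w)
    rw [mulI_mulI, map_neg] at this
    linarith
  obtain ⟨a, ha⟩ : ∃ a : E → E → E → ℝ, ∀ u v w, G p (Γ u v) w = a u v w := ⟨_, fun _ _ _ => rfl⟩
  have hd : ∀ u v w, fderiv ℝ G p u v w = a u v w + a u w v := fun u v w => by
    rw [← h.fderiv_apply, hΓ.metric, hs v, ha, ha]
  have hc : ∀ u v w, a u (mulI E v) w = - a u v (mulI E w) := fun u v w => by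
    rw [← ha, ← ha, hΓ.complex, hJ]
  have hk : ∀ u v w, a u v w - a v u w = - (a u w v - a w u v) := fun u v w => by
    simpa [ha] using hΓ.skew u v w
  funext u v
  refine hinj _ _ fun w => ?_
  rw [h.bismut_apply, ha]
  simp only [hd]
  have hcc : ∀ u v w, a u (mulI E v) (mulI E w) = a u v w := fun u v w => by
    have := hc u v (mulI E w)
    rw [this, mulI_mulI, ← ha, ← ha]; simp
  linarith [hk u v w, hk v w u, hk w u v, hk (mulI E u) (mulI E v) w, hk (mulI E v) w (mulI E u), hk w (mulI E u) (mulI E v), hk (mulI E u) v (mulI E w), hk v (mulI E w) (mulI E u), hk (mulI E w) (mulI E u) v, hk u (mulI E v) (mulI E w), hk (mulI E v) (mulI E w) u, hk (mulI E w) u (mulI E v), hcc u v w, hc (mulI E u) v w, hcc u w v, hc (mulI E u) w v, hcc v u w, hc (mulI E v) u w, hcc v w u, hc (mulI E v) w u, hcc w u v, hc (mulI E w) u v, hcc w v u, hc (mulI E w) v u]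

end Local

/-! ### Hermitian metrics on complex manifolds -/

section Manifold

variable {E : Type*} [NormedAddCommGroup E] [NormedSpace ℂ E]
  {X : Type*} [TopologicalSpace X] [ChartedSpace E X] [IsManifold 𝓘(ℂ, E) ω X]

/-- The complex structure of `X` on `T_x X`. The preferred chart at `x` identifies `T_x X` with
`E`, and transition maps are holomorphic, so this is multiplication by `i` in every chart. -/
def complexStructure (x : X) : TangentSpace 𝓘(ℝ, E) x →L[ℝ] TangentSpace 𝓘(ℝ, E) x :=
  mulI E

variable (E X) in
/-- A Hermitian metric on `X`: a smooth Riemannian metric `g` with `g(J u, J v) = g(u, v)`. -/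
structure HermitianMetric extends
    Bundle.ContMDiffRiemannianMetric 𝓘(ℝ, E) ∞ E (TangentSpace 𝓘(ℝ, E) : X → Type _) where
  hermitian (x : X) (u v : TangentSpace 𝓘(ℝ, E) x) :
    inner x (complexStructure x u) (complexStructure x v) = inner x u v

namespace HermitianMetric

variable (g : HermitianMetric E X)

/-! The connection, torsion and curvature of `g` are computed in the charts of the atlas, from the
coefficients of `g`. The three conditions below say that a tensor vanishes at all points of all
charts, on all tangent vectors. -/

/-- The coefficients of `g` in the chart `e`, i.e. the pull-back of `g` by `e⁻¹` to `e.target`: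
`(u, v) ↦ g(d(e⁻¹)_p u, d(e⁻¹)_p v)`. -/
def inChart (e : OpenPartialHomeomorph X E) (p : E) : E →L[ℝ] E →L[ℝ] ℝ :=
  let D : E →L[ℝ] E := mfderiv 𝓘(ℝ, E) 𝓘(ℝ, E) e.symm p
  let B : E →L[ℝ] E →L[ℝ] ℝ := g.inner (e.symm p)
  B.bilinearComp D D

open Bundle in
theorem inChart_apply_contDiffAt {e : OpenPartialHomeomorph X E} (he : e ∈ atlas E X) {p : E}
    (hp : p ∈ e.target) (u v : E) : ContDiffAt ℝ ∞ (fun q => g.inChart e q u v) p := by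
  have h1 : ContMDiffOn 𝓘(ℝ, E) 𝓘(ℝ, E) ω e.symm e.target :=
    contMDiffOn_symm_of_mem_maximalAtlas (IsManifold.subset_maximalAtlas he)
  have h2 := h1.contMDiffOn_tangentMapWithin (m := ∞) (by simp) e.open_target.uniqueMDiffOn
  have h3 : ∀ u : E, ContMDiffAt 𝓘(ℝ, E) (𝓘(ℝ, E).prod 𝓘(ℝ, E)) ∞
      (fun q => (TotalSpace.mk' E (e.symm q) (mfderiv 𝓘(ℝ, E) 𝓘(ℝ, E) e.symm q u) : TangentBundle 𝓘(ℝ, E) X)) p := by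
    intro u
    have h4 : ContMDiff 𝓘(ℝ, E) (𝓘(ℝ, E).prod 𝓘(ℝ, E)) ∞
      (fun q => (TotalSpace.mk' E q u : TangentBundle 𝓘(ℝ, E) E)) := by
      intro q
      rw [contMDiffAt_totalSpace]
      refine ⟨contMDiffAt_id, ?_⟩
      simp
      exact contMDiffAt_const
    have h5 := ContMDiffOn.comp (t := (TotalSpace.proj ⁻¹' e.target : Set (TangentBundle 𝓘(ℝ, E) E))) (f := fun q => (TotalSpace.mk' E q u : TangentBundle 𝓘(ℝ, E) E)) h2 (h4.contMDiffOn (s := e.target)) (fun q hq => hq)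
    refine (h5.congr (f₁ := fun q => (TotalSpace.mk' E (e.symm q) (mfderiv 𝓘(ℝ, E) 𝓘(ℝ, E) e.symm q u) : TangentBundle 𝓘(ℝ, E) X)) fun q hq => ?_).contMDiffAt (e.open_target.mem_nhds hp)
    simp only [Function.comp, tangentMapWithin]
    rw [mfderivWithin_of_isOpen e.open_target hq]
  have hb : ContMDiffAt 𝓘(ℝ, E) 𝓘(ℝ, E) ∞ e.symm p :=
    (h1.contMDiffAt (e.open_target.mem_nhds hp)).of_le le_top
  have : ContMDiffAt 𝓘(ℝ, E) (𝓘(ℝ, E).prod 𝓘(ℝ)) ∞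
      (fun m ↦ TotalSpace.mk' ℝ (E := Bundle.Trivial X ℝ) (e.symm m) (g.inner (e.symm m) (mfderiv 𝓘(ℝ, E) 𝓘(ℝ, E) e.symm m u) (mfderiv 𝓘(ℝ, E) 𝓘(ℝ, E) e.symm m v))) p := by
    apply ContMDiffAt.clm_bundle_apply₂ (F₁ := E) (F₂ := E)
    · exact ContMDiffAt.comp p g.contMDiff.contMDiffAt hb
    · exact h3 u
    · exact h3 v
  rw [contMDiffAt_totalSpace] at this
  exact this.2.contDiffAt

/-- The coefficients of `g` in a chart are smooth. -/
theorem inChart_contDiffAt [FiniteDimensional ℂ E] {e : OpenPartialHomeomorph X E}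
    (he : e ∈ atlas E X) {p : E} (hp : p ∈ e.target) :
    ContDiffAt ℝ ∞ (g.inChart e) p := by
  have : ContDiffOn ℝ ∞ (g.inChart e) e.target := by
    rw [contDiffOn_clm_apply]; intro u
    rw [contDiffOn_clm_apply]; intro v q hq
    exact (g.inChart_apply_contDiffAt he hq u v).contDiffWithinAt
  exact this.contDiffAt (e.open_target.mem_nhds hp)

/-- The differential of the inverse of a chart is complex linear. -/
theorem mfderiv_symm_mulI {e : OpenPartialHomeomorph X E} (he : e ∈ atlas E X) {p : E}
    (hp : p ∈ e.target) (v : E) : (mfderiv 𝓘(ℝ, E) 𝓘(ℝ, E) e.symm p (mulI E v) : E) = mulI E (mfderiv 𝓘(ℝ, E) 𝓘(ℝ, E) e.symm p v : E) := by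
  have h := (mdifferentiableAt_atlas_symm (I := 𝓘(ℂ, E)) he hp).hasMFDerivAt
  obtain ⟨L, hL⟩ : ∃ L : E →L[ℂ] E, HasMFDerivAt 𝓘(ℂ, E) 𝓘(ℂ, E) e.symm p L := ⟨_, h⟩
  have h' : HasMFDerivAt 𝓘(ℝ, E) 𝓘(ℝ, E) e.symm p (L.restrictScalars ℝ) := by
    refine ⟨hL.1, ?_⟩
    have := hL.2.restrictScalars ℝ
    exact this
  rw [h'.mfderiv]
  exact L.map_smul _ _

/-- In a chart, a Hermitian metric is given by a differentiable field of nondegenerate symmetric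
`J`-invariant forms, so that `bismut` is the unique Hermitian connection with totally
skew-symmetric torsion. -/
theorem inChart_isHermitianNear [FiniteDimensional ℂ E] {e : OpenPartialHomeomorph X E}
    (he : e ∈ atlas E X) {p : E} (hp : p ∈ e.target) :
    IsHermitianNear (g.inChart e) p := by
  have hinj : Function.Injective (mfderiv 𝓘(ℝ, E) 𝓘(ℝ, E) e.symm p) :=
    (mdifferentiable_of_mem_atlas (I := 𝓘(ℝ, E)) he).symm.mfderiv_injective hp
  refine ⟨(g.inChart_contDiffAt he hp).differentiableAt (by simp), ?_, ?_, ?_⟩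
  · have : Function.Injective (g.inChart e p) := by
      rw [injective_iff_map_eq_zero]
      intro u hu
      by_contra hne
      have h1 := g.pos (e.symm p) (mfderiv 𝓘(ℝ, E) 𝓘(ℝ, E) e.symm p u) (fun h0 => hne (hinj (h0.trans (map_zero _).symm)))
      have h2 := DFunLike.congr_fun hu u
      exact absurd h2 h1.ne'
    have hf : FiniteDimensional ℝ E := inferInstance
    have hd : Module.finrank ℝ E = Module.finrank ℝ (E →L[ℝ] ℝ) := by
      rw [← (LinearMap.toContinuousLinearMap (𝕜 := ℝ) (E := E) (F' := ℝ)).finrank_eq]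
      exact (Subspace.dual_finrank_eq).symm
    exact ⟨(LinearEquiv.ofInjectiveOfFinrankEq (g.inChart e p).toLinearMap this hd).toContinuousLinearEquiv, by ext; rfl⟩
  · exact Filter.Eventually.of_forall fun q v w => g.symm _ _ _
  · filter_upwards [e.open_target.mem_nhds hp] with q hq v w
    have h := g.hermitian (e.symm q) (mfderiv 𝓘(ℝ, E) 𝓘(ℝ, E) e.symm q v) (mfderiv 𝓘(ℝ, E) 𝓘(ℝ, E) e.symm q w)
    have hv : complexStructure (e.symm q) (mfderiv 𝓘(ℝ, E) 𝓘(ℝ, E) e.symm q v) = mfderiv 𝓘(ℝ, E) 𝓘(ℝ, E) e.symm q (mulI E v) := (mfderiv_symm_mulI he hq v).symm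
    have hw : complexStructure (e.symm q) (mfderiv 𝓘(ℝ, E) 𝓘(ℝ, E) e.symm q w) = mfderiv 𝓘(ℝ, E) 𝓘(ℝ, E) e.symm q (mulI E w) := (mfderiv_symm_mulI he hq w).symm
    rw [hv, hw] at h
    exact h

/-- The first Bianchi identity for the Bismut connection:
`R^B(x, y) z + R^B(y, z) x + R^B(z, x) y = 0`. -/
def BismutFirstBianchi : Prop :=
  ∀ e ∈ atlas E X, ∀ p ∈ e.target, ∀ x y z : E,
    curvature (g.inChart e) p x y z + curvature (g.inChart e) p y z x
      + curvature (g.inChart e) p z x y = 0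

/-- The torsion of the Bismut connection is parallel: `∇^B T^B = 0`. -/
def BismutTorsionParallel : Prop :=
  ∀ e ∈ atlas E X, ∀ p ∈ e.target, ∀ u x y z : E,
    covDerivTorsion (g.inChart e) p u x y z = 0

/-- The metric is strong Kähler with torsion (pluriclosed): the torsion 3-form of the Bismut
connection is closed, `d T^B = 0`. -/
def IsSKT : Prop :=
  ∀ e ∈ atlas E X, ∀ p ∈ e.target, ∀ x y z u : E,
    extDerivThree (torsionForm (g.inChart e)) p x y z u = 0

end HermitianMetric

end Manifold

end HermitianGeometry

end

namespace HermitianGeometry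

section LocalIdentities

variable {E : Type*} [NormedAddCommGroup E] [NormedSpace ℂ E]
  {G : E → E →L[ℝ] E →L[ℝ] ℝ} {p : E}

/-! Write ∇, R, T for the Bismut connection, its curvature and its torsion, C(x,y,z,u) for the
cyclic sum over x, y, z of (∇_x T)(y,z,u), and Q for `torsionSquare`. For any metric connection with
totally skew torsion, g(R(x,y)z + R(y,z)x + R(z,x)y, u) = C + Q (`cyclic_curvature_apply`) and
dT(x,y,z,u) = C − (∇_u T)(x,y,z) + 2Q (`extDerivThree_torsionForm`). If ∇T = 0, these reduce to Q
and 2Q, which gives (b). If the Bianchi identity holds, then C = −Q and dT = Q − ∇_u T. Parallel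
torsion then forces C = 0, so Q = 0 and dT = 0. Conversely dT = 0 gives (∇_u T)(x,y,z) = Q(x,y,z,u);
by the antisymmetry of Q the cyclic sum C equals −3Q, and C = −Q leaves Q = 0, hence ∇T = 0. -/

/-- The coefficients of the Bismut connection of a smooth metric are differentiable. -/
theorem differentiableAt_bismut [CompleteSpace E] (hG : ContDiffAt ℝ ∞ G p)
    (hinv : (G p).IsInvertible) (u v : E) : DifferentiableAt ℝ (fun q => bismut G q u v) p := by
  have hfd : ∀ {H : E → E →L[ℝ] E →L[ℝ] ℝ}, ContDiffAt ℝ ∞ H p →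
      DifferentiableAt ℝ (fderiv ℝ H) p := fun hH =>
    (hH.fderiv_right (m := 1) (by norm_cast)).differentiableAt (by simp)
  have hω : ContDiffAt ℝ ∞ (fundamentalForm G) p := by
    let L : (E →L[ℝ] E →L[ℝ] ℝ) →L[ℝ] (E →L[ℝ] E →L[ℝ] ℝ) :=
      ContinuousLinearMap.compL ℝ E (E →L[ℝ] ℝ) (E →L[ℝ] ℝ)
        ((ContinuousLinearMap.compL ℝ E E ℝ).flip (mulI E))
    exact L.contDiff.contDiffAt.comp p hG
  have hflip : ∀ {H : E → E →L[ℝ] E →L[ℝ] E →L[ℝ] ℝ}, DifferentiableAt ℝ H p → ∀ a b : E,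
      DifferentiableAt ℝ (fun q => ((H q).flip a).flip b) p := fun {H} hH a b => by
    have h1 : DifferentiableAt ℝ (fun q => (H q).flip) p :=
      (ContinuousLinearMap.flipₗᵢ ℝ E E (E →L[ℝ] ℝ)).differentiable.differentiableAt.comp p hH
    have h2 : DifferentiableAt ℝ (fun q => (H q).flip a) p :=
      h1.clm_apply (differentiableAt_const a)
    have h3 : DifferentiableAt ℝ (fun q => ((H q).flip a).flip) p :=
      (ContinuousLinearMap.flipₗᵢ ℝ E E ℝ).differentiable.differentiableAt.comp p h2
    exact h3.clm_apply (differentiableAt_const b)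
  have happ : ∀ {H : E → E →L[ℝ] E →L[ℝ] E →L[ℝ] ℝ}, DifferentiableAt ℝ H p → ∀ a b : E,
      DifferentiableAt ℝ (fun q => H q a b) p := fun hH a b =>
    (hH.clm_apply (differentiableAt_const a)).clm_apply (differentiableAt_const b)
  have hk : DifferentiableAt ℝ (fun q => koszul G q u v) p :=
    (((happ (hfd hG) u v).add (happ (hfd hG) v u)).sub (hflip (hfd hG) u v)).const_smul (1 / 2 : ℝ)
  have hd : DifferentiableAt ℝ (fun q => dcFundamentalForm G q u v) p := by
    have h1 : DifferentiableAt ℝ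
        (fun q => extDerivTwo (fundamentalForm G) q (mulI E u) (mulI E v)) p :=
      ((happ (hfd hω) _ _).sub (happ (hfd hω) _ _)).add (hflip (hfd hω) _ _)
    exact (h1.clm_comp (differentiableAt_const (mulI E))).neg
  -- Operator inversion is smooth near an invertible operator of a complete space.
  have hi : DifferentiableAt ℝ (fun q => (G q).inverse) p :=
    ((hinv.contDiffAt_map_inverse (n := 1)).differentiableAt (by simp)).comp p
      (hG.differentiableAt (by simp))
  exact hi.clm_apply (hk.add (hd.const_smul (1 / 2 : ℝ)))

/-! ### Symmetries and derivative of the torsion 3-form -/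

theorem torsionForm_swap_left (u v w : E) : torsionForm G p u v w = -torsionForm G p v u w := by
  rw [torsionForm, torsionForm, ← neg_apply, ← map_neg, torsion, torsion, neg_sub]

theorem torsionForm_swap_right (h : IsHermitianNear G p) (u v w : E) :
    torsionForm G p u v w = -torsionForm G p u w v :=
  (bismut_isHermitianSkew h).skew u v w

/-- The torsion 3-form is invariant under cyclic permutations. -/
theorem torsionForm_rotate (h : IsHermitianNear G p) (u v w : E) :
    torsionForm G p u v w = torsionForm G p v w u := by
  rw [torsionForm_swap_left, torsionForm_swap_right h, neg_neg]

/-- Rotating moves the first argument into the last slot, where linearity is built in because that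
slot is an argument of the bilinear form `G p`. -/
theorem torsionForm_torsion_left (h : IsHermitianNear G p) (x y v w : E) :
    torsionForm G p (torsion G p x y) v w =
      torsionForm G p (bismut G p x y) v w - torsionForm G p (bismut G p y x) v w := by
  simp only [torsionForm_rotate h _ v w]
  rw [torsion]
  exact map_sub (G p (torsion G p v w)) _ _

theorem torsionForm_torsion (h : IsHermitianNear G p) (x y z u : E) :
    torsionForm G p (torsion G p x y) z u = G p (torsion G p x y) (torsion G p z u) := by
  rw [torsionForm_rotate h, torsionForm, h.symm.self_of_nhds]

/-- The product rule for the torsion form. -/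
theorem fderiv_torsionForm (h : IsHermitianNear G p)
    (hb : ∀ u v, DifferentiableAt ℝ (fun q => bismut G q u v) p) (x y z u : E) :
    fderiv ℝ (fun q => torsionForm G q y z u) p x =
      G p (fderiv ℝ (fun q => bismut G q y z) p x - fderiv ℝ (fun q => bismut G q z y) p x) u
        + G p (bismut G p x (torsion G p y z)) u + torsionForm G p y z (bismut G p x u) := by
  have hT : HasFDerivAt (fun q => torsion G q y z)
      (fderiv ℝ (fun q => bismut G q y z) p - fderiv ℝ (fun q => bismut G q z y) p) p :=
    (hb y z).hasFDerivAt.sub (hb z y).hasFDerivAt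
  have h1 : HasFDerivAt (fun q => torsionForm G q y z u) _ p :=
    (h.diff.hasFDerivAt.clm_apply hT).clm_apply (hasFDerivAt_const u p)
  -- ∇g = 0 trades the derivative of the metric coefficients for connection terms.
  have h2 := (bismut_isHermitianSkew h).metric x (torsion G p y z) u
  rw [h.fderiv_apply] at h2
  rw [h1.fderiv, torsionForm]
  simp
  linarith

theorem fderiv_torsionForm_swap_left (x y z u : E) :
    fderiv ℝ (fun q => torsionForm G q y z u) p x =
      -fderiv ℝ (fun q => torsionForm G q z y u) p x := by
  rw [funext fun q => torsionForm_swap_left (G := G) (p := q) y z u, fderiv_fun_neg]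
  rfl

/-! ### The quadratic torsion term and its antisymmetry -/

/-- The sum `g(T(x, y), T(z, u)) + g(T(y, z), T(x, u)) + g(T(z, x), T(y, u))`. -/
noncomputable def torsionSquare (G : E → E →L[ℝ] E →L[ℝ] ℝ) (p x y z u : E) : ℝ :=
  G p (torsion G p x y) (torsion G p z u) + G p (torsion G p y z) (torsion G p x u)
    + G p (torsion G p z x) (torsion G p y u)

/-- The cyclic sum of the covariant derivative of the torsion in the first three arguments. -/
noncomputable def cyclicCovDerivTorsion (G : E → E →L[ℝ] E →L[ℝ] ℝ) (p x y z u : E) : ℝ :=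
  covDerivTorsion G p x y z u + covDerivTorsion G p y z x u + covDerivTorsion G p z x y u

theorem torsion_swap (u v : E) : torsion G p u v = -torsion G p v u := by
  rw [torsion, torsion, neg_sub]

/-- A cyclic permutation of all four arguments changes the sign of `torsionSquare`. -/
theorem torsionSquare_rotate (h : IsHermitianNear G p) (x y z u : E) :
    torsionSquare G p y z u x = -torsionSquare G p x y z u := by
  have hs := h.symm.self_of_nhds
  simp only [torsionSquare]
  -- Each swap produces one sign; symmetry of g then puts the factors of two of the three products
  -- back in order.
  rw [torsion_swap u x, torsion_swap z x, torsion_swap y x, torsion_swap u y,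
    hs (torsion G p z u)]
  simp only [map_neg, neg_apply]
  rw [hs (torsion G p y u)]
  ring

theorem torsionSquare_rotate_three (x y z u : E) :
    torsionSquare G p y z x u = torsionSquare G p x y z u := by
  simp only [torsionSquare]
  ring

/-! ### The two identities for the curvature and for dT -/

/-- The first Bianchi identity of a metric connection with skew-symmetric torsion. -/
theorem cyclic_curvature_apply (h : IsHermitianNear G p)
    (hb : ∀ u v, DifferentiableAt ℝ (fun q => bismut G q u v) p) (x y z u : E) :
    G p (curvature G p x y z + curvature G p y z x + curvature G p z x y) u =
      cyclicCovDerivTorsion G p x y z u + torsionSquare G p x y z u := by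
  -- Additivity of ∇_a in its second argument is read off from ∇g = 0, since `bismut` is not bundled
  -- as a linear map: all other terms of that equation are linear in the differentiated vector.
  have hadd : ∀ a b c, G p (bismut G p a (torsion G p b c)) u =
      G p (bismut G p a (bismut G p b c)) u - G p (bismut G p a (bismut G p c b)) u := by
    intro a b c
    have e := fun v => (bismut_isHermitianSkew h).metric a v u
    simp only [h.fderiv_apply] at e
    have e1 := e (torsion G p b c)
    have e2 := e (bismut G p b c)
    have e3 := e (bismut G p c b)
    rw [torsion] at e1 ⊢
    simp only [map_sub, sub_apply] at e1
    linarith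
  -- Written as T(∇_x y, z, u) − T(∇_y x, z, u), the terms of Q can cancel the connection terms of
  -- the covariant derivatives.
  have hsq := fun a b c => torsionForm_torsion h a b c u
  simp only [torsionForm_torsion_left h] at hsq
  simp only [torsionSquare, ← hsq, cyclicCovDerivTorsion, covDerivTorsion,
    fderiv_torsionForm h hb, hadd, curvature, map_add, map_sub, add_apply, sub_apply]
  rw [torsionForm_swap_left y (bismut G p x z), torsionForm_swap_left z (bismut G p y x),
    torsionForm_swap_left x (bismut G p z y)]
  ring

/-- The exterior derivative of the torsion form in terms of its covariant derivative. -/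
theorem extDerivThree_torsionForm (h : IsHermitianNear G p) (x y z u : E) :
    extDerivThree (torsionForm G) p x y z u =
      cyclicCovDerivTorsion G p x y z u - covDerivTorsion G p u x y z
        + 2 * torsionSquare G p x y z u := by
  have hsq := fun a b c d => torsionForm_torsion h a b c d
  simp only [torsionForm_torsion_left h] at hsq
  have hs := h.symm.self_of_nhds
  -- One copy of Q is transposed in g, so that all six pairs from x, y, z, u occur as inner
  -- torsions. Their twelve terms ∇_a b match the twelve corrections in the four covariant
  -- derivatives.
  have h2 : 2 * torsionSquare G p x y z u = torsionSquare G p x y z u +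
      (G p (torsion G p z u) (torsion G p x y) + G p (torsion G p x u) (torsion G p y z)
        + G p (torsion G p y u) (torsion G p z x)) := by
    rw [hs (torsion G p z u), hs (torsion G p x u), hs (torsion G p y u), torsionSquare]
    ring
  rw [h2]
  simp only [torsionSquare, ← hsq, cyclicCovDerivTorsion, covDerivTorsion, extDerivThree]
  rw [fderiv_torsionForm_swap_left y x z u,
    torsionForm_swap_left y (bismut G p x z), torsionForm_swap_left z (bismut G p y x),
    torsionForm_swap_left x (bismut G p z y),
    torsionForm_rotate h (bismut G p z u), torsionForm_rotate h (bismut G p u z),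
    torsionForm_rotate h (bismut G p x u), torsionForm_rotate h (bismut G p y u),
    torsionForm_rotate h x (bismut G p u y)]
  rw [torsionForm_rotate h (bismut G p u y) z x]
  linarith [torsionForm_rotate h (bismut G p u x) y z]

/-- Nondegeneracy of g lets the vector identity be tested by pairing with every u. -/
theorem curvature_cyclic_eq_zero_iff (h : IsHermitianNear G p)
    (hb : ∀ u v, DifferentiableAt ℝ (fun q => bismut G q u v) p) (x y z : E) :
    curvature G p x y z + curvature G p y z x + curvature G p z x y = 0 ↔
      ∀ u, cyclicCovDerivTorsion G p x y z u + torsionSquare G p x y z u = 0 := by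
  simp only [← cyclic_curvature_apply h hb]
  refine ⟨fun h0 u => by simp [h0], fun h0 => h.inv.injective ?_⟩
  ext u
  simpa using h0 u

/-! ### The two equivalences at a point -/

/-- If the Bismut connection satisfies the first Bianchi identity, then its torsion is parallel
if and only if it is closed. -/
theorem covDerivTorsion_eq_zero_iff_of_bianchi (h : IsHermitianNear G p)
    (hB : ∀ x y z u, cyclicCovDerivTorsion G p x y z u + torsionSquare G p x y z u = 0) :
    (∀ u x y z, covDerivTorsion G p u x y z = 0) ↔
      ∀ x y z u, extDerivThree (torsionForm G) p x y z u = 0 := by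
  simp only [extDerivThree_torsionForm h]
  constructor
  · intro hT x y z u
    have := hB x y z u
    simp only [cyclicCovDerivTorsion, hT] at this ⊢
    linarith
  · intro hd
    have hT : ∀ u x y z, covDerivTorsion G p u x y z = torsionSquare G p x y z u :=
      fun u x y z => by linarith [hB x y z u, hd x y z u]
    intro u x y z
    have h0 := hB x y z u
    -- Each of the three covariant derivatives becomes a permuted Q equal to −Q(x,y,z,u), so `h0`
    -- says −3Q + Q = 0.
    simp only [cyclicCovDerivTorsion, hT] at h0
    rw [hT]
    linarith [torsionSquare_rotate h x y z u, torsionSquare_rotate h y z x u,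
      torsionSquare_rotate h z x y u, torsionSquare_rotate_three (G := G) (p := p) x y z u,
      torsionSquare_rotate_three (G := G) (p := p) y z x u]

/-- If the torsion of the Bismut connection is parallel, then the first Bianchi identity holds
if and only if the torsion is closed. -/
theorem bianchi_iff_of_covDerivTorsion_eq_zero (h : IsHermitianNear G p)
    (hT : ∀ u x y z, covDerivTorsion G p u x y z = 0) :
    (∀ x y z u, cyclicCovDerivTorsion G p x y z u + torsionSquare G p x y z u = 0) ↔
      ∀ x y z u, extDerivThree (torsionForm G) p x y z u = 0 := by
  simp [extDerivThree_torsionForm h, cyclicCovDerivTorsion, hT]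

end LocalIdentities

/-! ### Passage to the manifold, chart by chart -/

namespace HermitianMetric

variable {E : Type*} [NormedAddCommGroup E] [NormedSpace ℂ E] [FiniteDimensional ℂ E]
  {X : Type*} [TopologicalSpace X] [ChartedSpace E X] [IsManifold 𝓘(ℂ, E) ω X]

theorem bismutFirstBianchi_iff (g : HermitianMetric E X) :
    g.BismutFirstBianchi ↔ ∀ e ∈ atlas E X, ∀ p ∈ e.target, ∀ x y z u : E,
      cyclicCovDerivTorsion (g.inChart e) p x y z u
        + torsionSquare (g.inChart e) p x y z u = 0 := by
  have : CompleteSpace E := FiniteDimensional.complete ℂ E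
  refine forall₄_congr fun e he p hp => forall₃_congr fun x y z => ?_
  have h := g.inChart_isHermitianNear he hp
  exact curvature_cyclic_eq_zero_iff h
    (differentiableAt_bismut (g.inChart_contDiffAt he hp) h.inv) x y z

end HermitianMetric

end HermitianGeometry

theorem mainTheorem3 {E : Type*} [NormedAddCommGroup E] [NormedSpace ℂ E] [FiniteDimensional ℂ E]
    {X : Type*} [TopologicalSpace X] [ChartedSpace E X] [IsManifold 𝓘(ℂ, E) ω X]
    (g : HermitianGeometry.HermitianMetric E X) :
    (g.BismutFirstBianchi → (g.BismutTorsionParallel ↔ g.IsSKT)) ∧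
      (g.BismutTorsionParallel → (g.BismutFirstBianchi ↔ g.IsSKT)) := by
  rw [g.bismutFirstBianchi_iff]
  -- Both equivalences already hold at each single point of each chart.
  refine ⟨fun hB => forall₄_congr fun e he p hp => ?_, fun hT => forall₄_congr fun e he p hp => ?_⟩
  · exact HermitianGeometry.covDerivTorsion_eq_zero_iff_of_bianchi
      (g.inChart_isHermitianNear he hp) (hB e he p hp)
  · exact HermitianGeometry.bianchi_iff_of_covDerivTorsion_eq_zero
      (g.inChart_isHermitianNear he hp) (hT e he p hp)
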